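/- Let $k$ be an algebraically closed field of characteristic $0$, let $Y$ be an irreducible normal algebraic variety over $k$ with smooth locus $Y_{\rm sm}$, let $B$ be a prime divisor of $Y$ with support $\operatorname{supp}(B)$, and let $b\geq 1$ be an integer. Let $\tau$ be a nonzero rational tensor field of type $\binom pq$ on $Y$, i.e. a nonzero rational section of $T(Y_{\rm sm})^{\otimes p}\otimes T^*(Y_{\rm sm})^{\otimes q}$. Call $(V,v)$ *adapted to $B$* if $V\subseteq Y_{\rm sm}$ is open with $\operatorname{supp}(B)\cap V\neq\varnothing$ and $v=(v_1,\dots,v_n)$ is a system of functions in $k[V]$ such that $v_n$ generates the ideal of $\operatorname{supp}(B)\cap V$ in $k[V]$ and $dv_1(a),\dots,dv_n(a)$ is a basis of the cotangent space $T^*_{a,V}$ for every point $a\in V$. Let $\partial/\partial v_1,\dots,\partial/\partial v_n$ be the vector fields with $dv_i(\partial/\partial v_j)=\delta_{ij}$, and write $$\tau=\sum \tau^{i_1\dots i_p}_{j_1\dots j_q}\,\frac{\partial}{\partial v_{i_1}}\otimes\cdots\otimes\frac{\partial}{\partial v_{i_p}}\otimes dv_{j_1}\otimes\cdots\otimes dv_{j_q},\qquad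 \tau^{i_1\dots i_p}_{j_1\dots j_q}\in k(Y).$$ For an adapted $(V,v)$ put $$\varrho(bB,\tau)_{V,v}=\min\bigl\{(b-1)(q'-p')+b\,m\bigr\},$$ the minimum being over all $i_1,\dots,i_p,j_1,\dots,j_q$ with $\tau^{i_1\dots i_p}_{j_1\dots j_q}\neq0$, where $m$ is the order of $\tau^{i_1\dots i_p}_{j_1\dots j_q}$ along $B$, $p'$ is the number of indices among $i_1,\dots,i_p$ equal to $n$ (factors $\partial/\partial v_n$), and $q'$ is the number of indices among $j_1,\dots,j_q$ equal to $n$ (factors $dv_n$). Then the integer $\varrho(bB,\tau)_{V,v}$ is defined for every adapted $(V,v)$, and it depends only on $\tau$ and $bB$: it is the same for all adapted $(V,v)$. -/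

import Mathlib

open AlgebraicGeometry CategoryTheory TensorProduct

universe u

namespace TensorFieldDivisor

noncomputable section

/-- The local ring `𝒪_{Y,a}` of a `k`-scheme `Y` is a `k`-algebra, through the structure morphism.
For the generic point this is the `k`-algebra structure of the function field `k(Y)`. -/
instance stalkAlgebra (k : Type u) [Field k] (Y : Scheme.{u}) [Y.Over (Spec (CommRingCat.of k))]
    (a : Y) : Algebra k (Y.presheaf.stalk a) :=
  ((Scheme.ΓSpecIso (CommRingCat.of k)).inv ≫ (Y ↘ Spec (CommRingCat.of k)).appTop ≫
    Y.presheaf.germ ⊤ a trivial).hom.toAlgebra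

/-- The order of vanishing `m_{C, div g}` of a rational function `g` along the prime divisor with
generic point `C` (meant for `g ≠ 0` and `C` of codimension one). -/
def ordAlong (k : Type u) [Field k] {Y : Scheme.{u}} [Y.Over (Spec (CommRingCat.of k))]
    [IsIntegral Y] [LocallyOfFinitePresentation (Y ↘ Spec (CommRingCat.of k))]
    (C : Y) (g : Y.functionField) : ℤ :=
  haveI : IsLocallyNoetherian Y :=
    LocallyOfFiniteType.isLocallyNoetherian (Y ↘ Spec (CommRingCat.of k))
  Scheme.ord g C

/-- Rational tensor fields of type `(p, q)` on `Y`: rational sections of the vector bundle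
`T(Y_sm)^{⊗ p} ⊗ T^*(Y_sm)^{⊗ q}`, i.e. elements of the stalk of this bundle at the generic point.
The stalk of the tangent bundle is the space of `k`-derivations of `k(Y)` (rational vector fields),
that of the cotangent bundle is the space of Kähler differentials of `k(Y)` over `k`
(rational `1`-forms). -/
abbrev RationalTensorField (k : Type u) [Field k] (Y : Scheme.{u})
    [Y.Over (Spec (CommRingCat.of k))] [IsIntegral Y] (p q : ℕ) : Type u :=
  (⨂[Y.functionField] (_ : Fin p), Derivation k Y.functionField Y.functionField)
    ⊗[Y.functionField] (⨂[Y.functionField] (_ : Fin q), Ω[Y.functionField⁄k])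

/-- The ideal of `k[V]` of the functions that vanish on `closure {C} ∩ V`. -/
def idealOfClosure {Y : Scheme.{u}} (C : Y) (V : Y.Opens) : Ideal Γ(Y, V) :=
  ⨅ (a : V) (_ : a.1 ∈ closure ({C} : Set Y)),
    (IsLocalRing.maximalIdeal (Y.presheaf.stalk a.1)).comap (Y.presheaf.germ V a.1 a.2).hom

/-- The value `df(a)` at `a ∈ V` of the differential of a regular function `f ∈ k[V]`, in the fibre
`κ(a) ⊗ Ω_{Y,a}` of the cotangent bundle at `a` (for closed `a` this is the cotangent space of `Y`
at `a`). -/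
def differentialAt (k : Type u) [Field k] {Y : Scheme.{u}} [Y.Over (Spec (CommRingCat.of k))]
    {V : Y.Opens} (f : Γ(Y, V)) (a : Y) (ha : a ∈ V) :
    IsLocalRing.ResidueField (Y.presheaf.stalk a) ⊗[Y.presheaf.stalk a]
      Ω[Y.presheaf.stalk a⁄k] :=
  1 ⊗ₜ KaehlerDifferential.D k (Y.presheaf.stalk a) (Y.presheaf.germ V a ha f)

/-- A choice of `V` and `v = (v_1, …, v_n)`, `n = d + 1`, adapted to the prime divisor `B` of `Y`
with generic point `C` (so `supp B = closure {C}`). The last coordinate `v (Fin.last d)` is `v_n`. -/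
structure LocalCoordinates (k : Type u) [Field k] {Y : Scheme.{u}}
    [Y.Over (Spec (CommRingCat.of k))]
    [LocallyOfFinitePresentation (Y ↘ Spec (CommRingCat.of k))] (C : Y) (d : ℕ) where
  /-- the open set `V` of the smooth locus -/
  V : Y.Opens
  le_smoothLocus : V ≤ (Y ↘ Spec (CommRingCat.of k)).smoothLocus
  /-- `V` meets the support of the divisor -/
  meets : (closure ({C} : Set Y) ∩ V).Nonempty
  /-- the coordinate functions -/
  v : Fin (d + 1) → Γ(Y, V)
  /-- `v_n` generates the ideal of `supp B ∩ V` in `k[V]` -/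
  span_last : Ideal.span {v (Fin.last d)} = idealOfClosure C V
  /-- `dv_1(a), …, dv_n(a)` is a basis of the cotangent space at every (closed) point `a` of `V` -/
  basis : ∀ (a : Y) (ha : a ∈ V), IsClosed ({a} : Set Y) →
    LinearIndependent (IsLocalRing.ResidueField (Y.presheaf.stalk a))
      (fun i => differentialAt k (v i) a ha) ∧
    Submodule.span (IsLocalRing.ResidueField (Y.presheaf.stalk a))
      (Set.range fun i => differentialAt k (v i) a ha) = ⊤

section

variable {k : Type u} [Field k] {Y : Scheme.{u}} [Y.Over (Spec (CommRingCat.of k))] [IsIntegral Y]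
  [LocallyOfFinitePresentation (Y ↘ Spec (CommRingCat.of k))] {C : Y} {d : ℕ}

/-- The coordinate `v_i` as a rational function on `Y`. -/
def LocalCoordinates.ratCoord (c : LocalCoordinates k C d) (i : Fin (d + 1)) : Y.functionField :=
  haveI : Nonempty c.V := ⟨⟨_, c.meets.choose_spec.2⟩⟩
  Y.germToFunctionField c.V (c.v i)

/-- The rational `1`-form `dv_i`. -/
def LocalCoordinates.dv (c : LocalCoordinates k C d) (i : Fin (d + 1)) : Ω[Y.functionField⁄k] :=
  KaehlerDifferential.D k Y.functionField (c.ratCoord i)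

/-- `e` is the system of vector fields `∂/∂v_1, …, ∂/∂v_n`, defined by `dv_i (∂/∂v_j) = δ_{ij}`. -/
def LocalCoordinates.IsDualFrame (c : LocalCoordinates k C d)
    (e : Fin (d + 1) → Derivation k Y.functionField Y.functionField) : Prop :=
  ∀ i j, e j (c.ratCoord i) = if i = j then 1 else 0

/-- The monomial `∂/∂v_{i_1} ⊗ ⋯ ⊗ ∂/∂v_{i_p} ⊗ dv_{j_1} ⊗ ⋯ ⊗ dv_{j_q}`, where
`e = (∂/∂v_1, …, ∂/∂v_n)`. -/
def LocalCoordinates.monomial (c : LocalCoordinates k C d)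
    (e : Fin (d + 1) → Derivation k Y.functionField Y.functionField) {p q : ℕ}
    (I : Fin p → Fin (d + 1)) (J : Fin q → Fin (d + 1)) : RationalTensorField k Y p q :=
  (PiTensorProduct.tprod Y.functionField fun s => e (I s)) ⊗ₜ[Y.functionField]
    (PiTensorProduct.tprod Y.functionField fun t => c.dv (J t))

/-- `x I J` are the components `τ^{i_1 … i_p}_{j_1 … j_q} ∈ k(Y)` of `τ` in the coordinates `v`. -/
def LocalCoordinates.IsComponents (c : LocalCoordinates k C d) {p q : ℕ}
    (τ : RationalTensorField k Y p q)
    (x : (Fin p → Fin (d + 1)) → (Fin q → Fin (d + 1)) → Y.functionField) : Prop :=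
  ∃ e : Fin (d + 1) → Derivation k Y.functionField Y.functionField,
    c.IsDualFrame e ∧ τ = ∑ I, ∑ J, x I J • c.monomial e I J

/-- The number of indices of the multi-index `I` equal to `n`: the number `p'` of factors `∂/∂v_n`,
or `q'` of factors `dv_n`. -/
def lastCount {d p : ℕ} (I : Fin p → Fin (d + 1)) : ℕ :=
  (Finset.univ.filter fun s => I s = Fin.last d).card

/-- `μ(bB, δ) = (b - 1)(q' - p') + b m` for `δ = g ∂/∂v_{i_1} ⊗ ⋯ ⊗ dv_{j_q}`, `g ≠ 0`, where `m`
is the order of `g` along `B`. -/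
def LocalCoordinates.mu (_c : LocalCoordinates k C d) (b : ℕ) {p q : ℕ}
    (I : Fin p → Fin (d + 1)) (J : Fin q → Fin (d + 1)) (g : Y.functionField) : ℤ :=
  ((b : ℤ) - 1) * ((lastCount J : ℤ) - (lastCount I : ℤ)) + (b : ℤ) * ordAlong k C g

/-- `r = ϱ(bB, τ)_{V,v}`: it is the minimum of `μ(bB, δ)` over the nonzero terms `δ` of the
decomposition of `τ` in the coordinates `v`. -/
def LocalCoordinates.IsRho (c : LocalCoordinates k C d) (b : ℕ) {p q : ℕ}
    (τ : RationalTensorField k Y p q) (r : ℤ) : Prop :=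
  ∃ x : (Fin p → Fin (d + 1)) → (Fin q → Fin (d + 1)) → Y.functionField,
    c.IsComponents τ x ∧
      IsLeast {s : ℤ | ∃ I J, x I J ≠ 0 ∧ s = c.mu b I J (x I J)} r

end

end

end TensorFieldDivisor

/-! Give the index `n` the weight `b - 1` and every other index the weight `0`, and write `w(I)` for
the total weight of a multi-index. Then `ϱ ≥ r` says exactly that every nonzero component satisfies
`b · ord ≥ r + w(I) - w(J)`. The sets `{g | b · ord g ≥ s}` form a multiplicative filtration of
`k(Y)`, so this condition survives a change of coordinates as soon as each `∂v'_j/∂v_i` has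
filtration level at least `w(j) - w(i)` (`repr_mem_of_weighted_change`).

The level bound is `dualFrame_ratCoord_mem`. The differentials `dv_i` form a basis of the
differentials of the discrete valuation ring `𝒪_C`, so all these partial derivatives lie in `𝒪_C`;
this suffices unless `j = n` and `i ≠ n`. In that case `v_n` is a uniformizer, so `v'_n = v_n u`
with `u ∈ 𝒪_C` and `∂v'_n/∂v_i = v_n ∂u/∂v_i` has order at least `1`, whence `b · ord ≥ b ≥ b - 1`.
Exchanging the two coordinate systems gives equality of the two minima. -/

namespace TensorFieldDivisor

/-! ### Local rings, their differentials, and generization -/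

section Stalks

variable (k : Type u) [Field k] {Y : Scheme.{u}} [Y.Over (Spec (CommRingCat.of k))]

theorem stalkSpecializes_algebraMap {x y : Y} (h : x ⤳ y) (r : k) :
    Y.presheaf.stalkSpecializes h (algebraMap k (Y.presheaf.stalk y) r) =
      algebraMap k (Y.presheaf.stalk x) r :=
  Y.presheaf.germ_stalkSpecializes_apply (U := ⊤) trivial h
    (((Scheme.ΓSpecIso (CommRingCat.of k)).inv ≫ (Y ↘ Spec (CommRingCat.of k)).appTop) r)

theorem algebraMap_stalk_eq_comp (a : Y) :
    algebraMap k (Y.presheaf.stalk a) =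
      ((Y ↘ Spec (CommRingCat.of k)).stalkMap a).hom.comp
        (StructureSheaf.toStalk k ((Y ↘ Spec (CommRingCat.of k)) a)).hom :=
  congrArg (fun f => ((Scheme.ΓSpecIso (CommRingCat.of k)).inv ≫ f).hom)
    (Scheme.Hom.germ_stalkMap (Y ↘ Spec (CommRingCat.of k)) ⊤ a trivial).symm

theorem formallySmooth_toStalk (R : Type u) [CommRing R] (x : PrimeSpectrum R) :
    (StructureSheaf.toStalk R x).hom.FormallySmooth :=
  letI := (StructureSheaf.toStalk R x).hom.toAlgebra
  have : IsLocalization x.asIdeal.primeCompl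
      ((structurePresheafInCommRingCat R).stalk x) :=
    StructureSheaf.IsLocalization.to_stalk R x
  Algebra.FormallySmooth.of_isLocalization x.asIdeal.primeCompl

theorem essFiniteType_toStalk (R : Type u) [CommRing R] (x : PrimeSpectrum R) :
    (StructureSheaf.toStalk R x).hom.EssFiniteType :=
  letI := (StructureSheaf.toStalk R x).hom.toAlgebra
  have : IsLocalization x.asIdeal.primeCompl
      ((structurePresheafInCommRingCat R).stalk x) :=
    StructureSheaf.IsLocalization.to_stalk R x
  Algebra.EssFiniteType.of_isLocalization _ x.asIdeal.primeCompl

theorem formallySmooth_stalk [LocallyOfFinitePresentation (Y ↘ Spec (CommRingCat.of k))] {a : Y}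
    (ha : a ∈ (Y ↘ Spec (CommRingCat.of k)).smoothLocus) :
    Algebra.FormallySmooth k (Y.presheaf.stalk a) := by
  rw [← RingHom.formallySmooth_algebraMap, algebraMap_stalk_eq_comp]
  exact (formallySmooth_toStalk k _).comp ha

theorem essFiniteType_stalk [LocallyOfFiniteType (Y ↘ Spec (CommRingCat.of k))] (a : Y) :
    Algebra.EssFiniteType k (Y.presheaf.stalk a) := by
  rw [← RingHom.essFiniteType_algebraMap, algebraMap_stalk_eq_comp]
  exact (essFiniteType_toStalk k _).comp (LocallyOfFiniteType.stalkMap _ a)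

/-- Both stalks are localizations of the sections over one affine neighbourhood of `y`, and whatever
becomes a unit at `y` is a unit at `x`. -/
theorem exists_isLocalization_stalkSpecializes (Y : Scheme.{u}) {x y : Y} (h : x ⤳ y) :
    letI := (Y.presheaf.stalkSpecializes h).hom.toAlgebra
    ∃ M : Submonoid (Y.presheaf.stalk y), IsLocalization M (Y.presheaf.stalk x) := by
  let := (Y.presheaf.stalkSpecializes h).hom.toAlgebra
  obtain ⟨_, ⟨U, hU, rfl⟩, hyU, -⟩ :=
    Y.isBasis_affineOpens.exists_subset_of_mem_open (Set.mem_univ y) isOpen_univ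
  have hxU : x ∈ U := h.mem_open U.isOpen hyU
  let := Y.presheaf.algebra_section_stalk (U := U) ⟨x, hxU⟩
  let := Y.presheaf.algebra_section_stalk (U := U) ⟨y, hyU⟩
  have hx := hU.isLocalization_stalk ⟨x, hxU⟩
  have hy := hU.isLocalization_stalk ⟨y, hyU⟩
  have : IsScalarTower Γ(Y, U) (Y.presheaf.stalk y) (Y.presheaf.stalk x) := by
    refine IsScalarTower.of_algebraMap_eq' ?_
    simp only [RingHom.algebraMap_toAlgebra]
    rw [← CommRingCat.hom_comp]
    congr 1
    exact (Y.presheaf.germ_stalkSpecializes hyU h).symm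
  refine ⟨_, IsLocalization.isLocalization_of_submonoid_le (Y.presheaf.stalk y)
    (Y.presheaf.stalk x) (hU.primeIdealOf ⟨y, hyU⟩).asIdeal.primeCompl
    (hU.primeIdealOf ⟨x, hxU⟩).asIdeal.primeCompl ?_⟩
  intro f hf
  have h1 : IsUnit (algebraMap Γ(Y, U) (Y.presheaf.stalk y) f) :=
    IsLocalization.map_units (M := (hU.primeIdealOf ⟨y, hyU⟩).asIdeal.primeCompl) _ ⟨f, hf⟩
  have h2 := h1.map (algebraMap (Y.presheaf.stalk y) (Y.presheaf.stalk x))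
  rw [← IsScalarTower.algebraMap_apply] at h2
  exact (IsLocalization.AtPrime.isUnit_to_map_iff (Y.presheaf.stalk x)
    (hU.primeIdealOf ⟨x, hxU⟩).asIdeal f).mp h2

theorem exists_basis_kaehler_of_specializes {x y : Y} (h : x ⤳ y) {ι : Type*}
    (f : ι → Y.presheaf.stalk y)
    (β : Module.Basis ι (Y.presheaf.stalk y) Ω[Y.presheaf.stalk y⁄k])
    (hβ : ∀ i, β i = KaehlerDifferential.D k _ (f i)) :
    ∃ γ : Module.Basis ι (Y.presheaf.stalk x) Ω[Y.presheaf.stalk x⁄k],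
      ∀ i, γ i = KaehlerDifferential.D k _ (Y.presheaf.stalkSpecializes h (f i)) := by
  let := (Y.presheaf.stalkSpecializes h).hom.toAlgebra
  obtain ⟨M, hM⟩ := exists_isLocalization_stalkSpecializes Y h
  have : IsScalarTower k (Y.presheaf.stalk y) (Y.presheaf.stalk x) :=
    IsScalarTower.of_algebraMap_eq fun r => (stalkSpecializes_algebraMap k h r).symm
  refine ⟨β.ofIsLocalizedModule (Y.presheaf.stalk x) M
    (KaehlerDifferential.map k k (Y.presheaf.stalk y) (Y.presheaf.stalk x)), fun i => ?_⟩
  rw [Module.Basis.ofIsLocalizedModule_apply, hβ, KaehlerDifferential.map_D]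
  rfl

end Stalks

/-! ### Adapted coordinates give bases of differentials -/

section Coordinates

variable {k : Type u} [Field k] {Y : Scheme.{u}} [Y.Over (Spec (CommRingCat.of k))]
  [LocallyOfFinitePresentation (Y ↘ Spec (CommRingCat.of k))] {C : Y} {d : ℕ}

namespace LocalCoordinates

theorem mem_V (c : LocalCoordinates k C d) : C ∈ c.V := by
  obtain ⟨a, ha, haV⟩ := c.meets
  exact (specializes_iff_mem_closure.mpr ha).mem_open c.V.isOpen haV

theorem exists_closed_specialization (c : LocalCoordinates k C d) :
    ∃ a ∈ c.V, IsClosed ({a} : Set Y) ∧ C ⤳ a := by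
  have : JacobsonSpace Y := LocallyOfFiniteType.jacobsonSpace (Y ↘ Spec (CommRingCat.of k))
  obtain ⟨a, ⟨h1, h2⟩, h3⟩ := nonempty_inter_closedPoints c.meets
    (isClosed_closure.isLocallyClosed.inter c.V.isOpen.isLocallyClosed)
  exact ⟨a, h2, h3, specializes_iff_mem_closure.mpr h1⟩

/-- Nakayama: at a smooth point the module of differentials is finite and projective, so a basis of
the fibre lifts to a basis. -/
theorem exists_basis_of_isClosed (c : LocalCoordinates k C d) {a : Y} (ha : a ∈ c.V)
    (hcl : IsClosed ({a} : Set Y)) :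
    ∃ β : Module.Basis (Fin (d + 1)) (Y.presheaf.stalk a) Ω[Y.presheaf.stalk a⁄k],
      ∀ i, β i = KaehlerDifferential.D k _ (Y.presheaf.germ c.V a ha (c.v i)) := by
  have := formallySmooth_stalk k (c.le_smoothLocus ha)
  have := essFiniteType_stalk k a
  obtain ⟨h1, h2⟩ := c.basis a ha hcl
  refine Module.exists_basis_of_basis_baseChange _ h1 h2 ?_
  exact Module.Flat.rTensor_preserves_injective_linearMap _ (Submodule.subtype_injective _)

/-- The differentials of the coordinates form a basis of the differentials of the local ring
at every point `x` that specializes to the generic point `C` of the divisor. -/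
theorem exists_basis_stalk (c : LocalCoordinates k C d) {x : Y} (hx : x ⤳ C) :
    ∃ β : Module.Basis (Fin (d + 1)) (Y.presheaf.stalk x) Ω[Y.presheaf.stalk x⁄k],
      ∀ i, β i = KaehlerDifferential.D k _
        (Y.presheaf.germ c.V x (hx.mem_open c.V.isOpen c.mem_V) (c.v i)) := by
  -- The basis hypothesis concerns closed points only, so it is used at a closed point of the
  -- divisor and then localized to `x`.
  obtain ⟨a, ha, hcl, hCa⟩ := c.exists_closed_specialization
  obtain ⟨β, hβ⟩ := c.exists_basis_of_isClosed ha hcl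
  obtain ⟨γ, hγ⟩ := exists_basis_kaehler_of_specializes k (hx.trans hCa) _ β hβ
  refine ⟨γ, fun i => ?_⟩
  rw [hγ, Y.presheaf.germ_stalkSpecializes_apply]

theorem germ_last_mem_maximalIdeal (c : LocalCoordinates k C d) :
    Y.presheaf.germ c.V C c.mem_V (c.v (Fin.last d)) ∈
      IsLocalRing.maximalIdeal (Y.presheaf.stalk C) := by
  have h : c.v (Fin.last d) ∈ idealOfClosure C c.V := by
    rw [← c.span_last]
    exact Ideal.mem_span_singleton_self _
  simp only [idealOfClosure, Submodule.mem_iInf] at h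
  exact h ⟨C, c.mem_V⟩ (subset_closure rfl)

end LocalCoordinates

end Coordinates

/-! ### Mixed tensors under a change of frame -/

section TensorBasis

variable {K M N ι : Type*} [Field K] [AddCommGroup M] [Module K M] [AddCommGroup N] [Module K N]

/-- The basis of `M^{⊗ p} ⊗ N^{⊗ q}` induced by bases of `M` and `N`. -/
noncomputable def mixedTensorBasis (e : Module.Basis ι K M) (θ : Module.Basis ι K N) (p q : ℕ) :
    Module.Basis ((Fin p → ι) × (Fin q → ι)) K
      ((⨂[K] (_ : Fin p), M) ⊗[K] (⨂[K] (_ : Fin q), N)) :=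
  (Basis.piTensorProduct fun _ => e).tensorProduct (Basis.piTensorProduct fun _ => θ)

theorem mixedTensorBasis_apply (e : Module.Basis ι K M) (θ : Module.Basis ι K N) {p q : ℕ}
    (I : Fin p → ι) (J : Fin q → ι) :
    mixedTensorBasis e θ p q (I, J) =
      (PiTensorProduct.tprod K fun s => e (I s)) ⊗ₜ[K]
        (PiTensorProduct.tprod K fun t => θ (J t)) := by
  simp [mixedTensorBasis, Module.Basis.tensorProduct_apply, Basis.piTensorProduct_apply]

theorem mixedTensorBasis_repr_apply (e e' : Module.Basis ι K M) (θ θ' : Module.Basis ι K N)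
    {p q : ℕ} (I I' : Fin p → ι) (J J' : Fin q → ι) :
    (mixedTensorBasis e' θ' p q).repr (mixedTensorBasis e θ p q (I, J)) (I', J') =
      (∏ s, e'.repr (e (I s)) (I' s)) * ∏ t, θ'.repr (θ (J t)) (J' t) := by
  rw [mixedTensorBasis_apply, mixedTensorBasis, Module.Basis.tensorProduct_repr_tmul_apply,
    Basis.piTensorProduct_repr_tprod_apply, Basis.piTensorProduct_repr_tprod_apply]
  simp [mul_comm]

/-- A change of frames whose coefficients respect the weights `w` of the indices preserves the
weight filtration of mixed tensors. -/
theorem repr_mem_of_weighted_change [Finite ι] (P : ℤ → AddSubmonoid K)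
    [SetLike.GradedMonoid P] (w : ι → ℤ)
    {e e' : Module.Basis ι K M} {θ θ' : Module.Basis ι K N}
    (he : ∀ i i', e'.repr (e i) i' ∈ P (w i' - w i))
    (hθ : ∀ j j', θ'.repr (θ j) j' ∈ P (w j - w j'))
    {p q : ℕ} {τ : (⨂[K] (_ : Fin p), M) ⊗[K] (⨂[K] (_ : Fin q), N)} {r : ℤ}
    (hτ : ∀ I J, (mixedTensorBasis e θ p q).repr τ (I, J) ∈
      P (r + ∑ s, w (I s) - ∑ t, w (J t))) (I' : Fin p → ι) (J' : Fin q → ι) :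
    (mixedTensorBasis e' θ' p q).repr τ (I', J') ∈ P (r + ∑ s, w (I' s) - ∑ t, w (J' t)) := by
  have := Fintype.ofFinite ι
  rw [← (mixedTensorBasis e θ p q).sum_repr τ]
  simp only [map_sum, map_smul, Finsupp.coe_finsetSum, Finset.sum_apply, Finsupp.smul_apply,
    smul_eq_mul]
  refine sum_mem fun x _ => ?_
  obtain ⟨I, J⟩ := x
  rw [mixedTensorBasis_repr_apply]
  have h1 : ∏ s, e'.repr (e (I s)) (I' s) ∈ P (∑ s, (w (I' s) - w (I s))) :=
    SetLike.prod_mem_graded P _ _ fun s _ => he _ _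
  have h2 : ∏ t, θ'.repr (θ (J t)) (J' t) ∈ P (∑ t, (w (J t) - w (J' t))) :=
    SetLike.prod_mem_graded P _ _ fun t _ => hθ _ _
  -- The weights of `I` and `J` cancel, leaving those of `I'` and `J'`.
  have h3 := SetLike.mul_mem_graded (hτ I J) (SetLike.mul_mem_graded h1 h2)
  convert h3 using 2
  simp only [Finset.sum_sub_distrib]
  ring

end TensorBasis

/-! ### Dual frames of derivations -/

section DualFrame

variable {k K ι : Type*} [Field k] [Field K] [Algebra k K] [Finite ι] [DecidableEq ι]

/-- The frame of derivations dual to a basis of the Kähler differentials. -/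
noncomputable def dualFrame (θ : Module.Basis ι K Ω[K⁄k]) : Module.Basis ι K (Derivation k K K) :=
  θ.dualBasis.map (KaehlerDifferential.linearMapEquivDerivation k K)

theorem dualFrame_apply (θ : Module.Basis ι K Ω[K⁄k]) (i : ι) (f : K) :
    dualFrame θ i f = θ.repr (KaehlerDifferential.D k K f) i := by
  rw [dualFrame, Module.Basis.map_apply, Module.Basis.coe_dualBasis]
  rfl

theorem dualFrame_unique {θ : Module.Basis ι K Ω[K⁄k]} {f : ι → K}
    (hθ : ∀ i, θ i = KaehlerDifferential.D k K (f i)) {e : ι → Derivation k K K}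
    (he : ∀ i j, e j (f i) = if i = j then 1 else 0) (j : ι) : e j = dualFrame θ j := by
  apply (KaehlerDifferential.linearMapEquivDerivation k K).symm.injective
  refine θ.ext fun i => ?_
  rw [KaehlerDifferential.linearMapEquivDerivation_symm_apply,
    KaehlerDifferential.linearMapEquivDerivation_symm_apply, hθ,
    Derivation.liftKaehlerDifferential_comp_D, Derivation.liftKaehlerDifferential_comp_D,
    dualFrame_apply, ← hθ, he, Module.Basis.repr_self, Finsupp.single_apply]

theorem dualFrame_repr {θ θ' : Module.Basis ι K Ω[K⁄k]} {f' : ι → K}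
    (hθ' : ∀ i, θ' i = KaehlerDifferential.D k K (f' i)) (i i' : ι) :
    (dualFrame θ').repr (dualFrame θ i) i' = dualFrame θ i (f' i') := by
  rw [dualFrame_apply, ← hθ']
  simp [dualFrame]

end DualFrame

/-! ### Differentials over a discrete valuation ring -/

section LocalRing

variable {k O ι : Type*} [Field k] [CommRing O] [Algebra k O]

/-- In `d(tu) = t du + u dt` the second term only has an `n`-th coordinate. -/
theorem repr_D_mul_of_ne (β : Module.Basis ι O Ω[O⁄k]) {t : O} {n i : ι}
    (ht : β n = KaehlerDifferential.D k O t) (hi : i ≠ n) (u : O) :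
    β.repr (KaehlerDifferential.D k O (t * u)) i = t * β.repr (KaehlerDifferential.D k O u) i := by
  rw [Derivation.leibniz, ← ht]
  simp [hi.symm]

/-- If `t` lay in the square of the maximal ideal, `dt` would vanish modulo that ideal and could not
be a basis vector. -/
theorem maximalIdeal_eq_span_of_basis [IsDomain O] [IsDiscreteValuationRing O]
    (β : Module.Basis ι O Ω[O⁄k]) {t : O} {n : ι} (ht : β n = KaehlerDifferential.D k O t)
    (hmem : t ∈ IsLocalRing.maximalIdeal O) : IsLocalRing.maximalIdeal O = Ideal.span {t} := by
  obtain ⟨ϖ, hϖ⟩ := IsDiscreteValuationRing.exists_irreducible O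
  rw [hϖ.maximalIdeal_eq] at hmem ⊢
  obtain ⟨a, rfl⟩ := Ideal.mem_span_singleton.mp hmem
  have ha : IsUnit a := by
    by_contra ha
    have h1 : β.repr (β n) n ∈ IsLocalRing.maximalIdeal O := by
      rw [ht, Derivation.leibniz]
      simp only [map_add, map_smul, Finsupp.add_apply, Finsupp.smul_apply, smul_eq_mul]
      refine add_mem (Ideal.mul_mem_right _ _ ?_) (Ideal.mul_mem_right _ _ ?_)
      · rw [hϖ.maximalIdeal_eq]; exact Ideal.mem_span_singleton_self _
      · exact ha
    simp at h1
  exact (Ideal.span_singleton_mul_right_unit ha ϖ).symm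

end LocalRing

/-! ### The order along the divisor and its filtration -/

section Order

variable {k : Type u} [Field k] {Y : Scheme.{u}} [Y.Over (Spec (CommRingCat.of k))] [IsIntegral Y]
  [LocallyOfFinitePresentation (Y ↘ Spec (CommRingCat.of k))] {C : Y}

theorem isDiscreteValuationRing_stalk [IsLocallyNoetherian Y] (hC : Order.coheight C = 1)
    [IsIntegrallyClosed (Y.presheaf.stalk C)] :
    IsDiscreteValuationRing (Y.presheaf.stalk C) := by
  have h1 : ringKrullDim (Y.presheaf.stalk C) = 1 := by
    rw [ringKrullDim_stalk_eq_coheight, hC]; rfl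
  have hf : ¬ IsField (Y.presheaf.stalk C) := fun h => by
    rw [ringKrullDim_eq_zero_of_isField h] at h1
    exact zero_ne_one h1
  have : Ring.KrullDimLE 1 (Y.presheaf.stalk C) := krullDimLE_of_coheight_le hC.le
  have : IsDedekindDomain (Y.presheaf.stalk C) :=
    { maximalOfPrime := fun hP h => Ring.krullDimLE_one_iff_of_isPrime_bot.mp this _ hP h }
  exact ((IsDiscreteValuationRing.TFAE _ hf).out 0 2).mpr this

theorem isLocallyNoetherian_of_over (k : Type u) [Field k] (Y : Scheme.{u})
    [Y.Over (Spec (CommRingCat.of k))]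
    [LocallyOfFinitePresentation (Y ↘ Spec (CommRingCat.of k))] : IsLocallyNoetherian Y :=
  LocallyOfFiniteType.isLocallyNoetherian (Y ↘ Spec (CommRingCat.of k))

theorem ordAlong_mul {f g : Y.functionField} (hf : f ≠ 0) (hg : g ≠ 0) :
    ordAlong k C (f * g) = ordAlong k C f + ordAlong k C g :=
  have := isLocallyNoetherian_of_over k Y
  Scheme.ord_mul hf hg

theorem ordAlong_add [IsDiscreteValuationRing (Y.presheaf.stalk C)] {f g : Y.functionField}
    (h : f + g ≠ 0) : min (ordAlong k C f) (ordAlong k C g) ≤ ordAlong k C (f + g) :=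
  have := isLocallyNoetherian_of_over k Y
  Scheme.ord_add h

theorem ordAlong_one : ordAlong k C (1 : Y.functionField) = 0 := by
  have := ordAlong_mul (k := k) (C := C) (one_ne_zero (α := Y.functionField)) one_ne_zero
  rw [mul_one] at this
  lia

theorem ordAlong_algebraMap_nonneg (hC : Order.coheight C = 1) {f : Y.presheaf.stalk C}
    (hf : f ≠ 0) : 0 ≤ ordAlong k C (algebraMap _ Y.functionField f) := by
  have := isLocallyNoetherian_of_over k Y
  have : Ring.KrullDimLE 1 (Y.presheaf.stalk C) := krullDimLE_of_coheight_le hC.le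
  have hf' : algebraMap _ Y.functionField f ≠ 0 := by simpa using hf
  exact (Scheme.le_ord_iff hC hf').mpr (Ring.ordFrac_ge_one_of_ne_zero hf)

theorem ordAlong_algebraMap_pos (hC : Order.coheight C = 1)
    [IsDiscreteValuationRing (Y.presheaf.stalk C)] {f : Y.presheaf.stalk C}
    (hf : f ≠ 0) (hm : f ∈ IsLocalRing.maximalIdeal (Y.presheaf.stalk C)) :
    0 < ordAlong k C (algebraMap _ Y.functionField f) := by
  have := isLocallyNoetherian_of_over k Y
  have : Ring.KrullDimLE 1 (Y.presheaf.stalk C) := krullDimLE_of_coheight_le hC.le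
  have hf' : algebraMap _ Y.functionField f ≠ 0 := by simpa using hf
  refine (ordAlong_algebraMap_nonneg hC hf).lt_of_ne' fun h => ?_
  exact hm (Ring.isUnit_iff_ordFrac_one_of_isDiscreteValuationRing.mpr
    ((Scheme.ord_eq_iff hC hf').mp h))

/-- The filtration of the function field by `b` times the order along `C`. -/
def orderFiltration (k : Type u) [Field k] {Y : Scheme.{u}} [Y.Over (Spec (CommRingCat.of k))]
    [IsIntegral Y] [LocallyOfFinitePresentation (Y ↘ Spec (CommRingCat.of k))] (C : Y)
    [IsDiscreteValuationRing (Y.presheaf.stalk C)] (b : ℕ) (s : ℤ) :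
    AddSubmonoid Y.functionField where
  -- The guard puts `0` in every level, whatever value `ordAlong` assigns to it.
  carrier := {g | g ≠ 0 → s ≤ b * ordAlong k C g}
  zero_mem' h := absurd rfl h
  add_mem' {f g} hf hg h := by
    by_cases hf0 : f = 0
    · subst hf0; rw [zero_add] at h ⊢; exact hg h
    by_cases hg0 : g = 0
    · subst hg0; rw [add_zero] at h ⊢; exact hf h
    have hb : (0 : ℤ) ≤ b := Int.natCast_nonneg b
    rcases min_le_iff.mp (ordAlong_add (k := k) (C := C) h) with h' | h'
    · exact (hf hf0).trans (mul_le_mul_of_nonneg_left h' hb)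
    · exact (hg hg0).trans (mul_le_mul_of_nonneg_left h' hb)

variable [IsDiscreteValuationRing (Y.presheaf.stalk C)]

theorem mem_orderFiltration {b : ℕ} {s : ℤ} {g : Y.functionField} :
    g ∈ orderFiltration k C b s ↔ (g ≠ 0 → s ≤ b * ordAlong k C g) := Iff.rfl

instance orderFiltration_gradedMonoid (b : ℕ) : SetLike.GradedMonoid (orderFiltration k C b) where
  one_mem _ := by rw [ordAlong_one, mul_zero]
  mul_mem s t f g hf hg h := by
    have hf0 := left_ne_zero_of_mul h
    have hg0 := right_ne_zero_of_mul h
    rw [ordAlong_mul hf0 hg0, mul_add]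
    exact add_le_add (hf hf0) (hg hg0)

end Order

/-! ### Independence of the coordinates -/

section Invariance

variable {k : Type u} [Field k] {Y : Scheme.{u}} [Y.Over (Spec (CommRingCat.of k))] [IsIntegral Y]
  [LocallyOfFinitePresentation (Y ↘ Spec (CommRingCat.of k))] {C : Y} {d : ℕ}

/-- The weight of the `i`-th coordinate: `b - 1` for the last coordinate and `0` otherwise. -/
def indexWeight (b : ℕ) (i : Fin (d + 1)) : ℤ := if i = Fin.last d then (b : ℤ) - 1 else 0

theorem sum_indexWeight (b : ℕ) {p : ℕ} (I : Fin p → Fin (d + 1)) :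
    ∑ s, indexWeight b (I s) = ((b : ℤ) - 1) * lastCount I := by
  simp [indexWeight, lastCount, Finset.sum_ite]
  ring

instance isScalarTower_functionField (x : Y) :
    IsScalarTower k (Y.presheaf.stalk x) Y.functionField :=
  IsScalarTower.of_algebraMap_eq fun r => (stalkSpecializes_algebraMap k _ r).symm

namespace LocalCoordinates

theorem exists_basis_dv (c : LocalCoordinates k C d) :
    ∃ θ : Module.Basis (Fin (d + 1)) Y.functionField Ω[Y.functionField⁄k], ∀ i, θ i = c.dv i :=
  c.exists_basis_stalk (x := genericPoint Y) (genericPoint_specializes C)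

/-- The basis of rational `1`-forms given by the differentials of the coordinates. -/
noncomputable def dvBasis (c : LocalCoordinates k C d) :
    Module.Basis (Fin (d + 1)) Y.functionField Ω[Y.functionField⁄k] :=
  c.exists_basis_dv.choose

theorem dvBasis_apply (c : LocalCoordinates k C d) (i : Fin (d + 1)) : c.dvBasis i = c.dv i :=
  c.exists_basis_dv.choose_spec i

/-- The coordinate `v_i` as an element of the local ring at the generic point of the divisor. -/
noncomputable def stalkCoord (c : LocalCoordinates k C d) (i : Fin (d + 1)) : Y.presheaf.stalk C :=
  Y.presheaf.germ c.V C c.mem_V (c.v i)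

theorem algebraMap_stalkCoord (c : LocalCoordinates k C d) (i : Fin (d + 1)) :
    algebraMap _ Y.functionField (c.stalkCoord i) = c.ratCoord i :=
  have : Nonempty c.V := ⟨⟨_, c.mem_V⟩⟩
  Scheme.algebraMap_germ_eq_germToFunctionField _ c.mem_V (c.v i)

omit [IsIntegral Y] in
theorem exists_basis_stalkCoord (c : LocalCoordinates k C d) :
    ∃ β : Module.Basis (Fin (d + 1)) (Y.presheaf.stalk C) Ω[Y.presheaf.stalk C⁄k],
      ∀ i, β i = KaehlerDifferential.D k _ (c.stalkCoord i) :=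
  c.exists_basis_stalk specializes_rfl

/-- Partial derivatives can be computed inside `𝒪_C`, so they map it to itself. -/
theorem dualFrame_algebraMap (c : LocalCoordinates k C d)
    {β : Module.Basis (Fin (d + 1)) (Y.presheaf.stalk C) Ω[Y.presheaf.stalk C⁄k]}
    (hβ : ∀ i, β i = KaehlerDifferential.D k _ (c.stalkCoord i)) (f : Y.presheaf.stalk C)
    (i : Fin (d + 1)) :
    dualFrame c.dvBasis i (algebraMap _ Y.functionField f) =
      algebraMap _ Y.functionField (β.repr (KaehlerDifferential.D k _ f) i) := by
  have h := congrArg (KaehlerDifferential.map k k (Y.presheaf.stalk C) Y.functionField)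
    (β.sum_repr (KaehlerDifferential.D k _ f))
  rw [KaehlerDifferential.map_D] at h
  rw [dualFrame_apply, ← h]
  simp only [map_sum, map_smul, hβ, KaehlerDifferential.map_D, c.algebraMap_stalkCoord]
  have hdv (j) : KaehlerDifferential.D k Y.functionField (c.ratCoord j) = c.dvBasis j :=
    (c.dvBasis_apply j).symm
  have hsmul (a : Y.presheaf.stalk C) (ω : Ω[Y.functionField⁄k]) :
      a • ω = algebraMap _ Y.functionField a • ω := (algebraMap_smul _ a ω).symm
  simp only [hdv, hsmul, map_smul, Module.Basis.repr_self]
  simp [Finsupp.single_apply, Algebra.smul_def]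

theorem dualFrame_ratCoord_mem [IsDiscreteValuationRing (Y.presheaf.stalk C)]
    (hC : Order.coheight C = 1) {b : ℕ} (hb : 1 ≤ b)
    (c c' : LocalCoordinates k C d) (i j : Fin (d + 1)) :
    dualFrame c.dvBasis i (c'.ratCoord j) ∈
      orderFiltration k C b (indexWeight b j - indexWeight b i) := by
  obtain ⟨β, hβ⟩ := c.exists_basis_stalkCoord
  rw [← c'.algebraMap_stalkCoord, c.dualFrame_algebraMap hβ, mem_orderFiltration]
  intro h0
  have hb' : (1 : ℤ) ≤ b := by exact_mod_cast hb
  have hne : β.repr (KaehlerDifferential.D k _ (c'.stalkCoord j)) i ≠ 0 := by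
    rintro h; rw [h, map_zero] at h0; exact h0 rfl
  have hnonneg := ordAlong_algebraMap_nonneg (k := k) hC hne
  by_cases hij : j = Fin.last d ∧ i ≠ Fin.last d
  -- The only case with a positive required level, namely `b - 1` when `b > 1`; divisibility by the
  -- uniformizer provides `b`.
  · obtain ⟨rfl, hi⟩ := hij
    have hspan := maximalIdeal_eq_span_of_basis β (hβ (Fin.last d)) c.germ_last_mem_maximalIdeal
    have hmem := c'.germ_last_mem_maximalIdeal
    rw [hspan] at hmem
    obtain ⟨u, hu⟩ := Ideal.mem_span_singleton.mp hmem
    have hpos := ordAlong_algebraMap_pos (k := k) hC hne (by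
      rw [stalkCoord, hu]
      erw [repr_D_mul_of_ne β (hβ _) hi]
      exact Ideal.mul_mem_right _ _ c.germ_last_mem_maximalIdeal)
    simp only [indexWeight, if_true, if_neg hi]
    nlinarith
  · have : indexWeight b j - indexWeight b i ≤ 0 := by
      unfold indexWeight; split_ifs <;> grind
    exact this.trans (by positivity)

/-- The components of a rational tensor field in the given coordinates. -/
noncomputable def components (c : LocalCoordinates k C d) {p q : ℕ}
    (τ : RationalTensorField k Y p q)
    (I : Fin p → Fin (d + 1)) (J : Fin q → Fin (d + 1)) : Y.functionField :=
  (mixedTensorBasis (dualFrame c.dvBasis) c.dvBasis p q).repr τ (I, J)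

/-- The conditions `dv_i(∂/∂v_j) = δ_{ij}` force the frame, and the monomials form a basis, so
existence and uniqueness of the components follow together. -/
theorem isComponents_iff (c : LocalCoordinates k C d) {p q : ℕ} {τ : RationalTensorField k Y p q}
    {x : (Fin p → Fin (d + 1)) → (Fin q → Fin (d + 1)) → Y.functionField} :
    c.IsComponents τ x ↔ x = c.components τ := by
  have hmon (I : Fin p → Fin (d + 1)) (J : Fin q → Fin (d + 1)) :
      c.monomial (dualFrame c.dvBasis) I J =
        mixedTensorBasis (dualFrame c.dvBasis) c.dvBasis p q (I, J) := by
    simp only [mixedTensorBasis_apply, monomial, c.dvBasis_apply]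
  constructor
  · rintro ⟨e, he, rfl⟩
    obtain rfl : e = dualFrame c.dvBasis :=
      funext fun j => dualFrame_unique c.dvBasis_apply he j
    ext I J
    simp only [components, hmon, ← Fintype.sum_prod_type'
      (f := fun I J => x I J • mixedTensorBasis (dualFrame c.dvBasis) c.dvBasis p q (I, J))]
    exact (congrFun (Module.Basis.repr_sum_self
      (mixedTensorBasis (dualFrame c.dvBasis) c.dvBasis p q) fun z => x z.1 z.2) (I, J)).symm
  · rintro rfl
    refine ⟨dualFrame c.dvBasis, fun i j => ?_, ?_⟩
    · rw [dualFrame_apply]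
      change c.dvBasis.repr (c.dv i) j = _
      rw [← dvBasis_apply, Module.Basis.repr_self, Finsupp.single_apply]
    · simp only [components, hmon, ← Fintype.sum_prod_type' (f := fun I J =>
        (mixedTensorBasis (dualFrame c.dvBasis) c.dvBasis p q).repr τ (I, J) •
          mixedTensorBasis (dualFrame c.dvBasis) c.dvBasis p q (I, J))]
      exact ((mixedTensorBasis (dualFrame c.dvBasis) c.dvBasis p q).sum_repr τ).symm

/-- The values of `μ` on the nonzero terms of the decomposition of `τ`. -/
def muSet (c : LocalCoordinates k C d) (b : ℕ) {p q : ℕ} (τ : RationalTensorField k Y p q) :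
    Set ℤ :=
  {s | ∃ I J, c.components τ I J ≠ 0 ∧ s = c.mu b I J (c.components τ I J)}

theorem isRho_iff (c : LocalCoordinates k C d) {b p q : ℕ} {τ : RationalTensorField k Y p q}
    {r : ℤ} : c.IsRho b τ r ↔ IsLeast (c.muSet b τ) r := by
  simp only [IsRho, isComponents_iff, exists_eq_left]
  rfl

theorem exists_isRho (c : LocalCoordinates k C d) (b : ℕ) {p q : ℕ}
    {τ : RationalTensorField k Y p q} (hτ : τ ≠ 0) : ∃ r, c.IsRho b τ r := by
  have hfin : (c.muSet b τ).Finite := by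
    refine (Set.finite_range fun z : (Fin p → Fin (d + 1)) × (Fin q → Fin (d + 1)) =>
      c.mu b z.1 z.2 (c.components τ z.1 z.2)).subset ?_
    rintro s ⟨I, J, -, rfl⟩
    exact ⟨(I, J), rfl⟩
  have hne : (c.muSet b τ).Nonempty := by
    by_contra h
    refine hτ ((mixedTensorBasis (dualFrame c.dvBasis) c.dvBasis p q).ext_elem fun z => ?_)
    by_contra hz
    rw [map_zero] at hz
    exact h ⟨_, z.1, z.2, hz, rfl⟩
  obtain ⟨r, hr, hmin⟩ := Set.exists_min_image _ id hfin hne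
  exact ⟨r, c.isRho_iff.mpr ⟨hr, hmin⟩⟩

theorem mem_lowerBounds_muSet_iff [IsDiscreteValuationRing (Y.presheaf.stalk C)]
    (c : LocalCoordinates k C d) {b p q : ℕ} {τ : RationalTensorField k Y p q} {r : ℤ} :
    r ∈ lowerBounds (c.muSet b τ) ↔ ∀ I J, c.components τ I J ∈
      orderFiltration k C b (r + ∑ s, indexWeight b (I s) - ∑ t, indexWeight b (J t)) := by
  simp only [sum_indexWeight, mem_orderFiltration]
  constructor
  · intro h I J h0
    have := h ⟨I, J, h0, rfl⟩
    rw [mu] at this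
    linarith
  · rintro h _ ⟨I, J, h0, rfl⟩
    have := h I J h0
    rw [mu]
    linarith

theorem isRho_le [IsDiscreteValuationRing (Y.presheaf.stalk C)] (hC : Order.coheight C = 1)
    {b : ℕ} (hb : 1 ≤ b) (c c' : LocalCoordinates k C d) {p q : ℕ}
    {τ : RationalTensorField k Y p q} {r r' : ℤ} (h : c.IsRho b τ r) (h' : c'.IsRho b τ r') :
    r ≤ r' := by
  rw [isRho_iff] at h h'
  refine c'.mem_lowerBounds_muSet_iff.mpr ?_ h'.1
  refine repr_mem_of_weighted_change (orderFiltration k C b) (indexWeight b)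
    (fun i i' => ?_) (fun j j' => ?_) (c.mem_lowerBounds_muSet_iff.mp h.2)
  -- Vector fields transform by `∂v'_{i'}/∂v_i`, forms by the inverse matrix `∂v_j/∂v'_{j'}`; both
  -- are covered by the same bound with the systems exchanged.
  · rw [dualFrame_repr c'.dvBasis_apply]
    exact dualFrame_ratCoord_mem hC hb c c' i i'
  · rw [dvBasis_apply, dv, ← dualFrame_apply]
    exact dualFrame_ratCoord_mem hC hb c' c j' j

/-- Both numbers of coordinates equal the dimension of the space of rational `1`-forms. -/
theorem dimension_eq {d' : ℕ} (c : LocalCoordinates k C d) (c' : LocalCoordinates k C d') :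
    d = d' := by
  simpa using Fintype.card_congr (c.dvBasis.indexEquiv c'.dvBasis)

end LocalCoordinates

end Invariance

end TensorFieldDivisor

theorem lemma3p6p2
    (k : Type u) [Field k] [IsAlgClosed k] [CharZero k]
    (Y : Scheme.{u}) [Y.Over (Spec (CommRingCat.of k))] [IsIntegral Y]
    [LocallyOfFinitePresentation (Y ↘ Spec (CommRingCat.of k))]
    [QuasiCompact (Y ↘ Spec (CommRingCat.of k))]
    [IsSeparated (Y ↘ Spec (CommRingCat.of k))]
    (hnormal : ∀ y : Y, IsIntegrallyClosed (Y.presheaf.stalk y))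
    (C : Y) (hC : Order.coheight C = 1) (b : ℕ) (hb : 1 ≤ b)
    (p q : ℕ) (τ : TensorFieldDivisor.RationalTensorField k Y p q) (hτ : τ ≠ 0) :
    ∃ r : ℤ, ∀ (d : ℕ) (c : TensorFieldDivisor.LocalCoordinates k C d) (s : ℤ),
      c.IsRho b τ s ↔ s = r := by
  have := TensorFieldDivisor.isLocallyNoetherian_of_over k Y
  have := hnormal C
  have := TensorFieldDivisor.isDiscreteValuationRing_stalk hC
  by_cases h : ∃ d₀, Nonempty (TensorFieldDivisor.LocalCoordinates k C d₀)
  · obtain ⟨d₀, ⟨c₀⟩⟩ := h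
    obtain ⟨r, hr⟩ := c₀.exists_isRho b hτ
    refine ⟨r, fun d c s => ?_⟩
    obtain rfl := c₀.dimension_eq c
    have huniq {s : ℤ} (hs : c.IsRho b τ s) : s = r :=
      le_antisymm (c.isRho_le hC hb c₀ hs hr) (c₀.isRho_le hC hb c hr hs)
    refine ⟨huniq, ?_⟩
    rintro rfl
    obtain ⟨s, hs⟩ := c.exists_isRho b hτ
    exact huniq hs ▸ hs
  -- Without adapted coordinates the claim is vacuous and `0` is arbitrary.
  · exact ⟨0, fun d c => (h ⟨d, ⟨c⟩⟩).elim⟩
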